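/- Let $T>0$, let $\mathbb X$ and $\mathbb V$ be real Hilbert spaces with duals $\mathbb X',\mathbb V'$, and let $A$ generate a $C_0$-semigroup $S$ on $\mathbb X$. Let $F:[0,T]\times\mathbb X\times\mathbb V\to\mathbb X$ be strongly measurable in $t$ and continuously Fréchet differentiable in $(y,u)$. Let $\bar u\in L^2(0,T;\mathbb V)$, and let $\bar y\in C([0,T];\mathbb X)$ be a mild solution of $$y'(t)=Ay(t)+F(t,y(t),\bar u(t)),\qquad y(0)=y_0,$$ satisfying the endpoint constraint $\bar y(T)=y_1$ (for instance, an optimal pair of an optimal control problem with terminal set $E=\{y_1\}$). Assume that $t\mapsto F_y(t,\bar y(t),\bar u(t))$ belongs to $L^1(0,T;\mathcal L(\mathbb X))$ and that $t\mapsto F_u(t,\bar y(t),\bar u(t))$ belongs to $L^2(0,T;\mathcal L(\mathbb V;\mathbb X))$. For $v\in L^2(0,T;\mathbb V)$ let $\xi(\cdot;v)$ be the mild solution of $$\xi'(t)=A\xi(t)+F_y(t,\bar y(t),\bar u(t))\xi(t)+F_u(t,\bar y(t),\bar u(t))v(t),\qquad \xi(0)=0,$$ and put $\mathcal M_3=\{\xi(T;v):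 |v|_{L^2(0,T;\mathbb V)}\le 1\}$. For $\phi_T\in\mathbb X'$ let $\phi$ be the mild solution of the adjoint equation $$\phi'(t)=-A^*\phi(t)-F_y(t,\bar y(t),\bar u(t))^*\phi(t),\qquad \phi(T)=\phi_T,$$ that is, $\phi\in C([0,T];\mathbb X')$ and $\phi(t)=S(T-t)^*\phi_T+\int_t^T S(s-t)^*F_y(s,\bar y(s),\bar u(s))^*\phi(s)\,ds$. A linear subspace is called finite codimensional if its quotient space is finite dimensional. A subset $D\subseteq\mathbb X$ is called finite codimensional in $\mathbb X$ if there is $x_0\in\overline{\mathrm{co}}\,D$ such that the closed linear span of $D-x_0$ is a finite codimensional subspace of $\mathbb X$ and $\overline{\mathrm{co}}(D-x_0)$ has an interior point relative to this subspace. Then the following assertions are equivalent: (1) The set $\mathcal M_3$ is finite codimensional in $\mathbb X$. (2) There are a finite codimensional subspace $\widetilde{\mathbb X}\subseteq\mathbb X'$ and a constant $\mathcal C>0$ such that, for every $\phi_T\in\widetilde{\mathbb X}$, $$|\phi_T|_{\mathbb X'}\le \mathcal C\,|F_u(\cdot,\bar y(\cdot),\bar u(\cdot))^*\phi|_{L^2(0,T;\mathbb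 V')}.$$ (3) There are a Banach space $W$, a compact linear operator $\mathcal G:\mathbb X'\to W$ and a constant $\mathcal C>0$ such that, for every $\phi_T\in\mathbb X'$, $$|\phi_T|_{\mathbb X'}\le \mathcal C\big(|F_u(\cdot,\bar y(\cdot),\bar u(\cdot))^*\phi|_{L^2(0,T;\mathbb V')}+|\mathcal G\phi_T|_W\big).$$ -/

import Mathlib

open MeasureTheory Set Filter Topology

universe u v w

namespace EvolutionControl

section Codimension

variable {X : Type u} [NormedAddCommGroup X] [NormedSpace ℝ X]

/-- The closed linear span of a set `D`. -/
def closedSpan (D : Set X) : Submodule ℝ X := (Submodule.span ℝ D).topologicalClosure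

/-- A subset `D` of `X` is finite codimensional in `X` if for some point `x₀` of the closed convex
hull of `D` the closed linear span of `D - x₀` has finite codimension in `X`, and the closed convex
hull of `D - x₀` has an interior point relative to that span. -/
def IsFiniteCodimSet (D : Set X) : Prop :=
  ∃ x₀ ∈ closedConvexHull ℝ D,
    (closedSpan ((fun x => x - x₀) '' D)).CoFG ∧
    (interior {z : closedSpan ((fun x => x - x₀) '' D) |
      (z : X) ∈ closedConvexHull ℝ ((fun x => x - x₀) '' D)}).Nonempty

end Codimension

section Semigroup

variable (X : Type u) [NormedAddCommGroup X] [NormedSpace ℝ X]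

/-- A strongly continuous (`C₀`) semigroup of bounded linear operators on `X`. Only the operators
`S t` with `0 ≤ t` matter. -/
structure C0Semigroup where
  toFun : ℝ → X →L[ℝ] X
  map_zero' : toFun 0 = ContinuousLinearMap.id ℝ X
  map_add' : ∀ s t : ℝ, 0 ≤ s → 0 ≤ t → toFun (s + t) = (toFun s).comp (toFun t)
  continuousOn' : ∀ x : X, ContinuousOn (fun t => toFun t x) (Ici 0)

instance : CoeFun (C0Semigroup X) (fun _ => ℝ → X →L[ℝ] X) := ⟨C0Semigroup.toFun⟩

variable {X}

/-- The (unbounded) operator `A` is the infinitesimal generator of `S`: its domain consists of those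
`x` for which `(S h x - x) / h` converges as `h → 0+`, and `A x` is the limit. -/
def IsGenerator (A : X →ₗ.[ℝ] X) (S : C0Semigroup X) : Prop :=
  ∀ x y : X, (x, y) ∈ A.graph ↔
    Tendsto (fun h : ℝ => h⁻¹ • (S h x - x)) (𝓝[>] 0) (𝓝 y)

/-- `y` is a mild solution on `[0, T]` of `y' = A y + f(t, y)`, `y(0) = y₀`, where `A` generates
`S`: a continuous function for which `f(·, y(·))` is integrable and
`y(t) = S(t) y₀ + ∫₀ᵗ S(t - s) f(s, y(s)) ds`. -/
structure IsMildSolution (S : C0Semigroup X) (T : ℝ) (f : ℝ → X → X) (y₀ : X) (y : ℝ → X) :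
    Prop where
  continuousOn : ContinuousOn y (Icc 0 T)
  intervalIntegrable : IntervalIntegrable (fun s => f s (y s)) volume 0 T
  eq : ∀ t ∈ Icc 0 T, y t = S t y₀ + ∫ s in (0 : ℝ)..t, S (t - s) (f s (y s))

end Semigroup

section Adjoint

variable {X : Type u} [NormedAddCommGroup X] [NormedSpace ℝ X]
  {Y : Type v} [NormedAddCommGroup Y] [NormedSpace ℝ Y]

/-- The adjoint `L* : Y' → X'`, `φ ↦ φ ∘ L`, of a bounded linear operator `L : X → Y`. -/
noncomputable def dualOp (L : X →L[ℝ] Y) : StrongDual ℝ Y →L[ℝ] StrongDual ℝ X :=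
  ContinuousLinearMap.precomp ℝ L

/-- `φ` is a mild solution on `[0, T]` of the backward equation `φ' = -A* φ - B(t)* φ`,
`φ(T) = φT`, in the dual space `X'`, where `A` generates `S`:
`φ(t) = S(T - t)* φT + ∫ₜᵀ S(s - t)* B(s)* φ(s) ds`. -/
structure IsAdjointMildSolution (S : C0Semigroup X) (T : ℝ) (B : ℝ → X →L[ℝ] X)
    (φT : StrongDual ℝ X) (φ : ℝ → StrongDual ℝ X) : Prop where
  continuousOn : ContinuousOn φ (Icc 0 T)
  intervalIntegrable : IntervalIntegrable (fun s => dualOp (B s) (φ s)) volume 0 T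
  eq : ∀ t ∈ Icc 0 T, φ t =
    dualOp (S (T - t)) φT + ∫ s in t..T, dualOp (S (s - t)) (dualOp (B s) (φ s))

end Adjoint

section Control

variable {X : Type u} [NormedAddCommGroup X] [NormedSpace ℝ X]
  {V : Type v} [NormedAddCommGroup V] [NormedSpace ℝ V]

/-- Lebesgue measure on the time interval `(0, T)`. -/
noncomputable def timeMeasure (T : ℝ) : Measure ℝ := volume.restrict (Ioo 0 T)

/-- The partial Fréchet derivative `F_y(t, y(t), u(t))` along the pair `(y, u)`. -/
noncomputable def partialY (F : ℝ → X → V → X) (y : ℝ → X) (u : ℝ → V) (t : ℝ) : X →L[ℝ] X :=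
  fderiv ℝ (fun x => F t x (u t)) (y t)

/-- The partial Fréchet derivative `F_u(t, y(t), u(t))` along the pair `(y, u)`. -/
noncomputable def partialU (F : ℝ → X → V → X) (y : ℝ → X) (u : ℝ → V) (t : ℝ) : V →L[ℝ] X :=
  fderiv ℝ (fun w => F t (y t) w) (u t)

/-- The set `{ξ(T; v) : |v|_{L²(0,T;V)} ≤ 1}`, where `ξ(·; v)` is the mild solution of
`ξ' = A ξ + B(t) ξ + D(t) v(t)`, `ξ(0) = 0`, and `A` generates `S`. -/
def reachableSet (S : C0Semigroup X) (T : ℝ) (B : ℝ → X →L[ℝ] X) (D : ℝ → V →L[ℝ] X) : Set X :=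
  {x | ∃ v : Lp V 2 (timeMeasure T), ‖v‖ ≤ 1 ∧
    ∃ ξ : ℝ → X, IsMildSolution S T (fun t z => B t z + D t (v t)) 0 ξ ∧ ξ T = x}

end Control

end EvolutionControl

namespace EvolutionControl

section FunctionalAnalysis

variable {X : Type u} [NormedAddCommGroup X] [NormedSpace ℝ X]
  {H : Type v} [NormedAddCommGroup H] [NormedSpace ℝ H]

@[simp] lemma dualOp_apply (L : H →L[ℝ] X) (φ : StrongDual ℝ X) (x : H) :
    dualOp L φ x = φ (L x) := rfl

/-- The kernel of a linear map into a finite dimensional space has finite codimension. -/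
lemma cofg_ker {E F : Type*} [AddCommGroup E] [Module ℝ E] [AddCommGroup F] [Module ℝ F]
    [FiniteDimensional ℝ F] (f : E →ₗ[ℝ] F) : (LinearMap.ker f).CoFG :=
  Module.Finite.equiv f.quotKerEquivRange.symm

/-- A closed subspace of finite codimension is the range of a bounded projection whose kernel is
finite dimensional. -/
lemma exists_projection [CompleteSpace X] (Y : Submodule ℝ X) (hY : IsClosed (Y : Set X))
    (hc : Y.CoFG) :
    ∃ P : X →L[ℝ] X, (∀ x, P x ∈ Y) ∧ (∀ y ∈ Y, P y = y) ∧
      FiniteDimensional ℝ (LinearMap.ker (P : X →ₗ[ℝ] X)) := by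
  obtain ⟨p, hp⟩ := Submodule.ClosedComplemented.of_finiteDimensional_quotient (𝕜 := ℝ) hY
  refine ⟨Y.subtypeL.comp p, fun x => (p x).2, fun y hy => by simp [hp ⟨y, hy⟩], ?_⟩
  have hdisj : Disjoint (LinearMap.ker ((Y.subtypeL.comp p : X →L[ℝ] X) : X →ₗ[ℝ] X)) Y := by
    rw [Submodule.disjoint_def]
    intro x hx hxY
    have h1 : ((p x : Y) : X) = 0 := hx
    rw [hp ⟨x, hxY⟩] at h1
    exact h1
  exact Module.Finite.iff_fg.mpr (Submodule.CoFG.fg_of_disjoint hdisj hc)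

/-- Functionals vanishing on a finite dimensional subspace form a subspace of finite
codimension. -/
lemma exists_annihilator_cofg (Z : Submodule ℝ X) [FiniteDimensional ℝ Z] :
    ∃ N : Submodule ℝ (StrongDual ℝ X), N.CoFG ∧ ∀ φ, φ ∈ N ↔ ∀ z ∈ Z, φ z = 0 := by
  let f : StrongDual ℝ X →ₗ[ℝ] (Z →ₗ[ℝ] ℝ) :=
    { toFun := fun φ => (φ : X →ₗ[ℝ] ℝ).comp Z.subtype
      map_add' := fun _ _ => rfl
      map_smul' := fun _ _ => rfl }
  refine ⟨LinearMap.ker f, cofg_ker f, fun φ => ?_⟩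
  rw [LinearMap.mem_ker, LinearMap.ext_iff]
  exact ⟨fun h z hz => h ⟨z, hz⟩, fun h z => h z z.2⟩

/-- The common kernel of a finite dimensional space of functionals has finite codimension. -/
lemma exists_preannihilator_cofg (K : Submodule ℝ (StrongDual ℝ X)) [FiniteDimensional ℝ K] :
    ∃ N : Submodule ℝ X, N.CoFG ∧ ∀ x, x ∈ N ↔ ∀ φ ∈ K, φ x = 0 := by
  obtain ⟨s, hs⟩ := Module.Finite.iff_fg.1 ‹FiniteDimensional ℝ K›
  let f : X →ₗ[ℝ] (s → ℝ) := LinearMap.pi fun φ => ((φ : StrongDual ℝ X) : X →ₗ[ℝ] ℝ)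
  refine ⟨LinearMap.ker f, cofg_ker f, fun x => ?_⟩
  rw [LinearMap.mem_ker, ← hs]
  constructor
  · intro h φ hφ
    induction hφ using Submodule.span_induction with
    | mem φ hφ => exact congrFun h ⟨φ, hφ⟩
    | zero => rfl
    | add φ ψ _ _ h₁ h₂ => rw [_root_.add_apply, h₁, h₂, add_zero]
    | smul c φ _ h => rw [_root_.smul_apply, h, smul_zero]
  · exact fun h => funext fun φ => h φ (Submodule.subset_span φ.2)

section Compact

variable {E : Type*} [NormedAddCommGroup E] [NormedSpace ℝ E] [CompleteSpace E]
  {F : Type*} [NormedAddCommGroup F] [NormedSpace ℝ F]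
  {W : Type*} [NormedAddCommGroup W] [NormedSpace ℝ W]
  {A : E →L[ℝ] F} {G : E →L[ℝ] W} {C : ℝ}

lemma exists_convergent_subseq (hG : IsCompactOperator G)
    (hC : ∀ x, ‖x‖ ≤ C * (‖A x‖ + ‖G x‖)) (x : ℕ → E) {r : ℝ} (hx : ∀ n, ‖x n‖ ≤ r)
    (hA : Tendsto (fun n => A (x n)) atTop (𝓝 0)) :
    ∃ a, ∃ k : ℕ → ℕ, StrictMono k ∧ Tendsto (x ∘ k) atTop (𝓝 a) := by
  obtain ⟨K, hK, hsub⟩ := hG.image_closedBall_subset_compact r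
  obtain ⟨w, -, k, hk, hw⟩ := hK.tendsto_subseq
    (fun n => hsub ⟨x n, by simpa using hx n, rfl⟩ : ∀ n, G (x n) ∈ K)
  have hP : AntilipschitzWith (2 * C).toNNReal (A.prod G) := by
    refine (A.prod G).antilipschitz_of_bound fun y => (hC y).trans ?_
    have h1 : ‖A y‖ ≤ ‖A.prod G y‖ := le_max_left _ _
    have h2 : ‖G y‖ ≤ ‖A.prod G y‖ := le_max_right _ _
    rcases le_or_gt 0 C with h | h
    · rw [Real.coe_toNNReal _ (by positivity)]
      nlinarith
    · exact (mul_nonpos_of_nonpos_of_nonneg h.le (by positivity)).trans (by positivity)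
  have hemb := hP.isClosedEmbedding (A.prod G).uniformContinuous
  have hlim : Tendsto (fun n => A.prod G (x (k n))) atTop (𝓝 (0, w)) :=
    (hA.comp hk.tendsto_atTop).prodMk_nhds hw
  obtain ⟨a, ha⟩ : ((0, w) : F × W) ∈ range (A.prod G) :=
    hemb.isClosed_range.mem_of_tendsto hlim (Eventually.of_forall fun n => ⟨_, rfl⟩)
  refine ⟨a, k, hk, ?_⟩
  rw [hemb.isInducing.tendsto_nhds_iff, ha]
  exact hlim

lemma finiteDimensional_ker_of_compact_estimate (hG : IsCompactOperator G)
    (hC : ∀ x, ‖x‖ ≤ C * (‖A x‖ + ‖G x‖)) :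
    FiniteDimensional ℝ (LinearMap.ker (A : E →ₗ[ℝ] F)) := by
  refine FiniteDimensional.of_isCompact_closedBall ℝ one_pos (c := 0) ?_
  refine IsSeqCompact.isCompact fun x hx => ?_
  obtain ⟨a, k, hk, ha⟩ := exists_convergent_subseq hG hC (fun n => (x n : E)) (r := 1)
    (fun n => by simpa using hx n)
    (tendsto_const_nhds.congr fun n => (LinearMap.mem_ker.1 (x n).2).symm)
  have hmem : a ∈ LinearMap.ker (A : E →ₗ[ℝ] F) :=
    A.isClosed_ker.mem_of_tendsto ha (Eventually.of_forall fun n => (x (k n)).2)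
  have ht : Tendsto (x ∘ k) atTop (𝓝 ⟨a, hmem⟩) := tendsto_subtype_rng.2 ha
  exact ⟨⟨a, hmem⟩, Metric.isClosed_closedBall.mem_of_tendsto ht
    (Eventually.of_forall fun n => hx (k n)), k, hk, ht⟩

lemma exists_bound_of_compact_estimate (hG : IsCompactOperator G)
    (hC : ∀ x, ‖x‖ ≤ C * (‖A x‖ + ‖G x‖)) {N : Set E} (hN : IsClosed N)
    (hsmul : ∀ (c : ℝ), ∀ x ∈ N, c • x ∈ N) (hker : ∀ x ∈ N, A x = 0 → x = 0) :
    ∃ C' : ℝ, 0 < C' ∧ ∀ x ∈ N, ‖x‖ ≤ C' * ‖A x‖ := by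
  by_contra! hcon
  have hc : ∀ n : ℕ, ∃ x ∈ N, ‖x‖ = 1 ∧ ‖A x‖ ≤ 1 / ((n : ℝ) + 1) := by
    intro n
    obtain ⟨y, hy, hlt⟩ := hcon (n + 1) (by positivity)
    have hy0 : 0 < ‖y‖ := lt_of_le_of_lt (by positivity) hlt
    refine ⟨‖y‖⁻¹ • y, hsmul _ _ hy, by rw [norm_smul, norm_inv, norm_norm]; field_simp, ?_⟩
    rw [map_smul, norm_smul, norm_inv, norm_norm, inv_mul_eq_div, div_le_div_iff₀ hy0 (by positivity)]
    linarith
  choose x hxN hx1 hxA using hc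
  have hA : Tendsto (fun n => A (x n)) atTop (𝓝 0) :=
    squeeze_zero_norm hxA tendsto_one_div_add_atTop_nhds_zero_nat
  obtain ⟨a, k, hk, ha⟩ := exists_convergent_subseq hG hC x (fun n => (hx1 n).le) hA
  have haN : a ∈ N := hN.mem_of_tendsto ha (Eventually.of_forall fun n => hxN _)
  have hAa : A a = 0 :=
    tendsto_nhds_unique ((A.continuous.tendsto a).comp ha) (hA.comp hk.tendsto_atTop)
  have h1 : ‖a‖ = 1 := tendsto_nhds_unique ha.norm
    (tendsto_const_nhds.congr fun n => (hx1 (k n)).symm)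
  rw [hker a haN hAa, norm_zero] at h1
  exact zero_ne_one h1

end Compact

variable (L : H →L[ℝ] X)

lemma abs_le_norm_dualOp_of_mem_closedConvexHull (φ : StrongDual ℝ X) {x : X}
    (hx : x ∈ closedConvexHull ℝ (L '' Metric.closedBall 0 1)) : |φ x| ≤ ‖dualOp L φ‖ := by
  have hsub : closedConvexHull ℝ (L '' Metric.closedBall 0 1) ⊆
      φ ⁻¹' Metric.closedBall 0 ‖dualOp L φ‖ := by
    refine closedConvexHull_min ?_ ((convex_closedBall _ _).is_linear_preimage
      (φ : X →ₗ[ℝ] ℝ).isLinear) (Metric.isClosed_closedBall.preimage φ.continuous)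
    rintro _ ⟨v, hv, rfl⟩
    rw [mem_preimage, mem_closedBall_zero_iff]
    exact (dualOp L φ).unit_le_opNorm v (by simpa using hv)
  simpa using hsub hx

lemma closedConvexHull_sub_subset (D : Set X) (x₀ : X) :
    closedConvexHull ℝ ((fun x => x - x₀) '' D) ⊆ {z | z + x₀ ∈ closedConvexHull ℝ D} := by
  refine closedConvexHull_min ?_ ?_ ?_
  · rintro _ ⟨x, hx, rfl⟩
    simpa using subset_closedConvexHull hx
  · have := (convex_closedConvexHull (𝕜 := ℝ) (s := D)).translate_preimage_left x₀
    exact this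
  · exact isClosed_closedConvexHull.preimage (continuous_id.add continuous_const)

lemma exists_estimate_of_isFiniteCodimSet [CompleteSpace X]
    (h : IsFiniteCodimSet (L '' Metric.closedBall 0 1)) :
    ∃ X₁ : Submodule ℝ (StrongDual ℝ X), X₁.CoFG ∧ ∃ C : ℝ, 0 < C ∧
      ∀ φ ∈ X₁, ‖φ‖ ≤ C * ‖dualOp L φ‖ := by
  obtain ⟨x₀, -, hfin, h⟩ := h
  set Y := closedSpan ((fun x => x - x₀) '' (L '' Metric.closedBall 0 1))
  obtain ⟨z₀, hz₀⟩ := h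
  obtain ⟨P, hPY, hP, hPfin⟩ := exists_projection Y (Submodule.isClosed_topologicalClosure _) hfin
  obtain ⟨X₁, hX₁, hmem⟩ := exists_annihilator_cofg (LinearMap.ker (P : X →ₗ[ℝ] X))
  obtain ⟨ε, hε, hball⟩ := Metric.mem_nhds_iff.1 (mem_interior_iff_mem_nhds.1 hz₀)
  have key : ∀ (φ : StrongDual ℝ X) (z : Y), z ∈ Metric.ball z₀ ε →
      |φ (z + x₀)| ≤ ‖dualOp L φ‖ := fun φ z hz =>
    abs_le_norm_dualOp_of_mem_closedConvexHull L φ (closedConvexHull_sub_subset _ _ (hball hz))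
  have hY : ∀ (φ : StrongDual ℝ X), ∀ y ∈ Y, |φ y| ≤ 4 / ε * ‖dualOp L φ‖ * ‖y‖ := by
    intro φ y hy
    rcases eq_or_ne y 0 with rfl | hy0
    · simp
    have hpos : 0 < ‖y‖ := norm_pos_iff.2 hy0
    set c : ℝ := ε / (2 * ‖y‖) with hc
    have hc0 : 0 < c := by positivity
    have h1 := key φ (z₀ + c • ⟨y, hy⟩) (by
      rw [mem_ball_iff_norm, add_sub_cancel_left, norm_smul, Real.norm_of_nonneg hc0.le,
        Submodule.coe_norm, hc]
      field_simp
      norm_num)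
    have h2 := key φ z₀ (Metric.mem_ball_self hε)
    have h3 : φ (c • y) = φ ((z₀ + c • (⟨y, hy⟩ : Y) : Y) + x₀) - φ (z₀ + x₀) := by
      rw [← map_sub]
      congr 1
      push_cast
      abel
    have h4 : c * |φ y| ≤ 2 * ‖dualOp L φ‖ := by
      rw [← abs_of_pos hc0, ← abs_mul, ← smul_eq_mul, ← map_smul, h3]
      exact (abs_sub _ _).trans (by linarith)
    calc |φ y| ≤ 2 * ‖dualOp L φ‖ / c := by rw [le_div_iff₀ hc0]; linarith
      _ = _ := by rw [hc]; field_simp; ring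
  refine ⟨X₁, hX₁, 4 / ε * (‖P‖ + 1), by positivity, fun φ hφ => ?_⟩
  refine φ.opNorm_le_bound (by positivity) fun x => ?_
  have hx : φ x = φ (P x) := by
    have := (hmem φ).1 hφ (x - P x) (by simp [hP _ (hPY x)])
    rwa [map_sub, sub_eq_zero] at this
  calc ‖φ x‖ = |φ (P x)| := by rw [hx, Real.norm_eq_abs]
    _ ≤ 4 / ε * ‖dualOp L φ‖ * ‖P x‖ := hY φ _ (hPY x)
    _ ≤ 4 / ε * ‖dualOp L φ‖ * ((‖P‖ + 1) * ‖x‖) := by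
      gcongr
      exact (P.le_opNorm x).trans (by gcongr; linarith)
    _ = _ := by ring

lemma exists_compact_estimate_of_estimate {E : Type*} [NormedAddCommGroup E] [NormedSpace ℝ E]
    [CompleteSpace E] {F : Type*} [NormedAddCommGroup F] [NormedSpace ℝ F] (A : E →L[ℝ] F)
    (h : ∃ X₁ : Submodule ℝ E, X₁.CoFG ∧ ∃ C : ℝ, 0 < C ∧ ∀ φ ∈ X₁, ‖φ‖ ≤ C * ‖A φ‖) :
    ∃ (W : Type w) (_ : NormedAddCommGroup W) (_ : NormedSpace ℝ W) (_ : CompleteSpace W)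
      (G : E →L[ℝ] W), IsCompactOperator G ∧ ∃ C : ℝ, 0 < C ∧
      ∀ φ, ‖φ‖ ≤ C * (‖A φ‖ + ‖G φ‖) := by
  obtain ⟨X₁, hX₁, C, hC, hest⟩ := h
  have hest' : ∀ φ ∈ X₁.topologicalClosure, ‖φ‖ ≤ C * ‖A φ‖ := by
    intro φ hφ
    refine closure_minimal (t := {φ | ‖φ‖ ≤ C * ‖A φ‖}) hest ?_ hφ
    exact isClosed_le continuous_norm (continuous_const.mul A.continuous.norm)
  obtain ⟨P, hPY, hP, hPfin⟩ := exists_projection X₁.topologicalClosure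
    (Submodule.isClosed_topologicalClosure _) inferInstance
  set Z := LinearMap.ker (P : E →ₗ[ℝ] E)
  let n := Module.finrank ℝ Z
  let e : Z ≃L[ℝ] ULift.{w} (Fin n → ℝ) :=
    (ContinuousLinearEquiv.ofFinrankEq (by simp [n])).trans ContinuousLinearEquiv.ulift.symm
  let Q : E →L[ℝ] Z := (ContinuousLinearMap.id ℝ E - P).codRestrict Z fun x => by
    simp [Z, hP _ (hPY x)]
  have hQ : ∀ x, ((Q x : Z) : E) = x - P x := fun _ => rfl
  let G : E →L[ℝ] ULift.{w} (Fin n → ℝ) := (e : Z →L[ℝ] ULift.{w} (Fin n → ℝ)).comp Q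
  let e' : ULift.{w} (Fin n → ℝ) →L[ℝ] Z := e.symm
  have : ProperSpace (ULift.{w} (Fin n → ℝ)) := FiniteDimensional.proper ℝ _
  refine ⟨ULift.{w} (Fin n → ℝ), inferInstance, inferInstance, FiniteDimensional.complete ℝ _, G,
    isCompactOperator_of_locallyCompactSpace_dom G,
    C + (C * ‖A‖ + 1) * (‖e'‖ + 1), by positivity, fun φ => ?_⟩
  have h1 : ‖φ - P φ‖ ≤ (‖e'‖ + 1) * ‖G φ‖ := by
    have : e' (G φ) = Q φ := e.symm_apply_apply (Q φ)
    rw [← hQ, ← this, ← Submodule.coe_norm]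
    exact (e'.le_opNorm _).trans (by gcongr; linarith)
  have h2 : ‖A (P φ)‖ ≤ ‖A φ‖ + ‖A‖ * ‖φ - P φ‖ := by
    have : A (P φ) = A φ - A (φ - P φ) := by simp
    rw [this]
    exact (norm_sub_le _ _).trans (by gcongr; exact A.le_opNorm _)
  have h3 := hest' _ (hPY φ)
  calc ‖φ‖ = ‖P φ + (φ - P φ)‖ := by simp
    _ ≤ ‖P φ‖ + ‖φ - P φ‖ := norm_add_le _ _
    _ ≤ C * (‖A φ‖ + ‖A‖ * ‖φ - P φ‖) + ‖φ - P φ‖ := by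
      gcongr
      exact h3.trans (by gcongr)
    _ = C * ‖A φ‖ + (C * ‖A‖ + 1) * ‖φ - P φ‖ := by ring
    _ ≤ C * ‖A φ‖ + (C * ‖A‖ + 1) * ((‖e'‖ + 1) * ‖G φ‖) := by gcongr
    _ ≤ (C + (C * ‖A‖ + 1) * (‖e'‖ + 1)) * ‖A φ‖ +
        (C + (C * ‖A‖ + 1) * (‖e'‖ + 1)) * ‖G φ‖ := by
      have : 0 ≤ (C * ‖A‖ + 1) * (‖e'‖ + 1) := by positivity
      rw [← mul_assoc]
      gcongr <;> linarith
    _ = _ := by ring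

lemma isFiniteCodimSet_of_compact_estimate [CompleteSpace X]
    {W : Type w} [NormedAddCommGroup W] [NormedSpace ℝ W] {G : StrongDual ℝ X →L[ℝ] W}
    (hG : IsCompactOperator G) {C : ℝ} (hC : ∀ φ, ‖φ‖ ≤ C * (‖dualOp L φ‖ + ‖G φ‖)) :
    IsFiniteCodimSet (L '' Metric.closedBall 0 1) := by
  set M := L '' Metric.closedBall 0 1 with hM
  have hfin := finiteDimensional_ker_of_compact_estimate hG hC
  have himg : (fun x => x - (0 : X)) '' M = M := by simp
  have hLM : ∀ v, L v ∈ closedSpan M := by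
    intro v
    have h1 : L ((‖v‖ + 1)⁻¹ • v) ∈ closedSpan M := by
      refine Submodule.le_topologicalClosure _ (Submodule.subset_span ⟨_, ?_, rfl⟩)
      rw [mem_closedBall_zero_iff, norm_smul, Real.norm_of_nonneg (by positivity),
        inv_mul_le_one₀ (by positivity)]
      linarith
    have h2 := (closedSpan M).smul_mem (‖v‖ + 1) h1
    rwa [← map_smul, smul_inv_smul₀ (by positivity)] at h2
  have hcofg : (closedSpan M).CoFG := by
    obtain ⟨N, hN, hmem⟩ := exists_preannihilator_cofg
      (LinearMap.ker (dualOp L : StrongDual ℝ X →ₗ[ℝ] StrongDual ℝ H))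
    refine Submodule.CoFG.of_le (S := N) ?_ hN
    intro x hx
    by_contra hxM
    obtain ⟨φ, r, hφ, hr⟩ := geometric_hahn_banach_closed_point (closedSpan M).convex
      (Submodule.isClosed_topologicalClosure _) hxM
    have hr0 : 0 < r := by simpa using hφ 0 (zero_mem _)
    have hker : dualOp L φ = 0 := by
      ext v
      by_contra hne
      rw [dualOp_apply, _root_.zero_apply] at hne
      have := hφ ((r / φ (L v)) • L v) ((closedSpan M).smul_mem _ (hLM v))
      rw [map_smul, smul_eq_mul, div_mul_cancel₀ _ hne] at this
      exact lt_irrefl _ this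
    have h0 : φ x = 0 := (hmem x).1 hx φ (LinearMap.mem_ker.2 hker)
    linarith
  obtain ⟨P, hPY, hP, hPfin⟩ := exists_projection (closedSpan M)
    (Submodule.isClosed_topologicalClosure _) hcofg
  obtain ⟨C', hC', hN⟩ := exists_bound_of_compact_estimate hG hC
    (N := {φ : StrongDual ℝ X | φ.comp P = φ})
    (isClosed_eq (dualOp P).continuous continuous_id)
    (fun c φ hφ => by
      have h : φ.comp P = φ := hφ
      change (c • φ).comp P = c • φ
      rw [ContinuousLinearMap.smul_comp, h])
    (fun φ hφ h0 => by
      have h : φ.comp P = φ := hφ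
      have hker : closedSpan M ≤ LinearMap.ker (φ : X →ₗ[ℝ] ℝ) := by
        refine Submodule.topologicalClosure_minimal _ (Submodule.span_le.2 ?_) φ.isClosed_ker
        rintro _ ⟨v, -, rfl⟩
        exact congrArg (fun ψ : StrongDual ℝ H => ψ v) h0
      ext x
      rw [← h]
      exact hker (hPY x))
  refine ⟨0, subset_closedConvexHull ⟨0, by simp, by simp⟩, ?_⟩
  rw [himg]
  refine ⟨hcofg, 0, mem_interior_iff_mem_nhds.2
    (Metric.mem_nhds_iff.2 ⟨C'⁻¹, by positivity, fun y hy => ?_⟩)⟩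
  by_contra hy'
  obtain ⟨φ, r, hφ, hr⟩ := geometric_hahn_banach_closed_point (convex_closedConvexHull (𝕜 := ℝ))
    isClosed_closedConvexHull hy'
  have hPL : ∀ v, P (L v) = L v := fun v => hP _ (hLM v)
  have hdual : dualOp L (φ.comp P) = dualOp L φ := by ext v; simp [hPL]
  have hψ := hN (φ.comp P) (by
    change (φ.comp P).comp P = φ.comp P
    ext x
    simp [hP _ (hPY x)])
  have hr0 : 0 < r := by
    simpa using hφ 0 (subset_closedConvexHull ⟨0, by simp, by simp⟩)
  have hle : ‖dualOp L φ‖ ≤ r := by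
    refine ContinuousLinearMap.opNorm_le_of_unit_norm hr0.le fun v hv => ?_
    rw [Real.norm_eq_abs, abs_le]
    have h1 := hφ (L v) (subset_closedConvexHull ⟨v, by simp [hv], rfl⟩)
    have h2 := hφ (L (-v)) (subset_closedConvexHull ⟨-v, by simp [hv], rfl⟩)
    rw [map_neg, map_neg] at h2
    constructor <;> simp only [dualOp_apply] <;> linarith
  have hyn : ‖(y : X)‖ < C'⁻¹ := by simpa using hy
  have h3 : φ y ≤ ‖φ.comp P‖ * ‖(y : X)‖ := by
    have := (φ.comp P).le_opNorm (y : X)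
    rw [ContinuousLinearMap.comp_apply, hP _ y.2] at this
    exact (le_abs_self _).trans this
  have h4 : ‖φ.comp P‖ * ‖(y : X)‖ ≤ C' * r * C'⁻¹ := by
    rw [hdual] at hψ
    gcongr
    exact hψ.trans (by gcongr)
  have h5 : C' * r * C'⁻¹ = r := by field_simp
  linarith

end FunctionalAnalysis
end EvolutionControl
namespace EvolutionControl

section Volterra

lemma intervalIntegrable_iff_integrable_timeMeasure {E : Type*} [NormedAddCommGroup E] {T : ℝ}
    (hT : 0 ≤ T) {f : ℝ → E} :
    IntervalIntegrable f volume 0 T ↔ Integrable f (timeMeasure T) :=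
  intervalIntegrable_iff_integrableOn_Ioo_of_le hT

lemma intervalIntegral_zero_eq {E : Type*} [NormedAddCommGroup E] [NormedSpace ℝ E] {T t : ℝ}
    (ht : t ∈ Icc 0 T) (f : ℝ → E) :
    ∫ s in (0 : ℝ)..t, f s = ∫ s, (Iio t).indicator f s ∂timeMeasure T := by
  rw [intervalIntegral.integral_of_le ht.1, integral_Ioc_eq_integral_Ioo,
    integral_indicator measurableSet_Iio, timeMeasure, Measure.restrict_restrict measurableSet_Iio]
  congr 2
  ext s
  simp only [mem_Ioo, mem_inter_iff, mem_Iio]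
  exact ⟨fun h => ⟨h.2, h.1, h.2.trans_le ht.2⟩, fun h => ⟨h.2.1, h.1⟩⟩

lemma intervalIntegral_end_eq {E : Type*} [NormedAddCommGroup E] [NormedSpace ℝ E] {T t : ℝ}
    (ht : t ∈ Icc 0 T) (f : ℝ → E) :
    ∫ s in t..T, f s = ∫ s, (Ioi t).indicator f s ∂timeMeasure T := by
  rw [intervalIntegral.integral_of_le ht.2, integral_Ioc_eq_integral_Ioo,
    integral_indicator measurableSet_Ioi, timeMeasure, Measure.restrict_restrict measurableSet_Ioi]
  congr 2
  ext s
  simp only [mem_Ioo, mem_inter_iff, mem_Ioi]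
  exact ⟨fun h => ⟨h.1, ht.1.trans_lt h.1, h.2⟩, fun h => ⟨h.1, h.2.2⟩⟩

/-- The exponentially weighted integrals of an integrable function are uniformly small. -/
lemma exists_exp_weight {T : ℝ} (hT : 0 ≤ T) {β : ℝ → ℝ} (hβ : Integrable β (timeMeasure T))
    {ε : ℝ} (hε : 0 < ε) :
    ∃ l : ℝ, 0 ≤ l ∧ ∀ t ∈ Icc 0 T, ∫ s in (0 : ℝ)..t, Real.exp (-l * (t - s)) * |β s| ≤ ε := by
  have hlim : Tendsto (fun n : ℕ => ∫ s, max (|β s| - n) 0 ∂timeMeasure T) atTop (𝓝 0) := by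
    have := tendsto_integral_of_dominated_convergence (μ := timeMeasure T)
      (F := fun (n : ℕ) s => max (|β s| - n) 0) (f := fun _ => (0 : ℝ)) (fun s => |β s|)
      (fun n => ((hβ.aestronglyMeasurable.norm.sub aestronglyMeasurable_const).sup
        aestronglyMeasurable_const)) hβ.abs
      (fun n => Eventually.of_forall fun s => by
        rw [Real.norm_of_nonneg (le_max_right _ _)]
        exact max_le (by linarith [Nat.cast_nonneg (α := ℝ) n]) (abs_nonneg _))
      (Eventually.of_forall fun s => by
        refine tendsto_const_nhds.congr' ?_
        filter_upwards [eventually_ge_atTop ⌈|β s|⌉₊] with n hn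
        have : |β s| ≤ n := (Nat.le_ceil _).trans (by exact_mod_cast hn)
        rw [max_eq_right (by linarith)])
    simpa using this
  obtain ⟨n, hn⟩ := (hlim.eventually (gt_mem_nhds (half_pos hε))).exists
  set l : ℝ := 2 * (n + 1) / ε with hl
  have hl0 : 0 < l := by positivity
  refine ⟨l, hl0.le, fun t ht => ?_⟩
  have hmax : Integrable (fun s => max (|β s| - n) 0) (timeMeasure T) := by
    refine hβ.abs.mono' ((hβ.aestronglyMeasurable.norm.sub aestronglyMeasurable_const).sup
        aestronglyMeasurable_const) (Eventually.of_forall fun s => ?_)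
    rw [Real.norm_of_nonneg (le_max_right _ _)]
    exact max_le (by linarith [Nat.cast_nonneg (α := ℝ) n]) (abs_nonneg _)
  have hsub : uIcc 0 t ⊆ uIcc 0 T := by
    rw [uIcc_of_le ht.1, uIcc_of_le hT]
    exact Icc_subset_Icc_right ht.2
  have hmax' := ((intervalIntegrable_iff_integrable_timeMeasure hT).2 hmax).mono_set hsub
  have hβ' := ((intervalIntegrable_iff_integrable_timeMeasure hT).2 hβ.abs).mono_set hsub
  have hexp : Continuous fun s : ℝ => Real.exp (-l * (t - s)) := by fun_prop
  have hderiv : ∀ s ∈ uIcc 0 t, HasDerivAt (fun s => l⁻¹ * Real.exp (-l * (t - s)))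
      (Real.exp (-l * (t - s))) s := by
    intro s _
    have h := (((hasDerivAt_id s).const_sub t).const_mul (-l)).exp.const_mul l⁻¹
    refine h.congr_deriv ?_
    simp only [id]
    field_simp
  have hint : ∫ s in (0 : ℝ)..t, Real.exp (-l * (t - s)) ≤ l⁻¹ := by
    rw [intervalIntegral.integral_eq_sub_of_hasDerivAt hderiv (hexp.intervalIntegrable _ _)]
    simp only [sub_self, mul_zero, Real.exp_zero, mul_one, sub_zero]
    have : 0 < l⁻¹ * Real.exp (-l * t) := by positivity
    linarith
  calc ∫ s in (0 : ℝ)..t, Real.exp (-l * (t - s)) * |β s|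
      ≤ ∫ s in (0 : ℝ)..t, ((n + 1) * Real.exp (-l * (t - s)) + max (|β s| - n) 0) := by
        refine intervalIntegral.integral_mono_on ht.1 (hβ'.continuousOn_mul hexp.continuousOn)
          (((hexp.intervalIntegrable _ _).const_mul _).add hmax') fun s hs => ?_
        have h1 : Real.exp (-l * (t - s)) ≤ 1 :=
          Real.exp_le_one_iff.2 (by nlinarith [hs.2])
        have h2 : |β s| - n ≤ max (|β s| - n) 0 := le_max_left _ _
        have h3 : 0 ≤ max (|β s| - n) 0 := le_max_right _ _
        have h4 := Real.exp_pos (-l * (t - s))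
        nlinarith
    _ = (n + 1) * (∫ s in (0 : ℝ)..t, Real.exp (-l * (t - s))) +
          ∫ s in (0 : ℝ)..t, max (|β s| - n) 0 := by
        rw [intervalIntegral.integral_add ((hexp.intervalIntegrable _ _).const_mul _) hmax',
          intervalIntegral.integral_const_mul]
    _ ≤ (n + 1) * l⁻¹ + ε / 2 := by
        gcongr
        refine le_trans ?_ hn.le
        rw [intervalIntegral_zero_eq ht]
        refine integral_mono (hmax.indicator measurableSet_Iio) hmax fun s => ?_
        exact indicator_le_self' (fun _ _ => le_max_right _ _) s
    _ = ε := by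
        rw [hl]
        field_simp
        norm_num

variable {X : Type u} [NormedAddCommGroup X] [NormedSpace ℝ X] {U : ℝ → X →L[ℝ] X} {M : ℝ}

lemma continuous_uncurry_of_bounded (hU : ∀ x, Continuous fun t => U t x) (hM : ∀ t, ‖U t‖ ≤ M) :
    Continuous fun p : ℝ × X => U p.1 p.2 := by
  rw [continuous_iff_continuousAt]
  rintro ⟨t₀, x₀⟩
  rw [ContinuousAt, tendsto_iff_norm_sub_tendsto_zero]
  have hM0 : 0 ≤ M := (norm_nonneg _).trans (hM 0)
  have h1 : Tendsto (fun p : ℝ × X => M * ‖p.2 - x₀‖ + ‖U p.1 x₀ - U t₀ x₀‖) (𝓝 (t₀, x₀)) (𝓝 0) := by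
    have : Continuous fun p : ℝ × X => M * ‖p.2 - x₀‖ + ‖U p.1 x₀ - U t₀ x₀‖ := by
      have := (hU x₀).comp (continuous_fst (X := ℝ) (Y := X))
      exact (continuous_const.mul (continuous_snd.sub continuous_const).norm).add
        (this.sub continuous_const).norm
    simpa using this.tendsto (t₀, x₀)
  refine squeeze_zero (fun _ => norm_nonneg _) (fun p => ?_) h1
  have : U p.1 p.2 - U t₀ x₀ = U p.1 (p.2 - x₀) + (U p.1 x₀ - U t₀ x₀) := by
    rw [map_sub]; abel
  rw [this]
  exact (norm_add_le _ _).trans (by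
    gcongr
    exact ((U p.1).le_opNorm _).trans (by gcongr; exact hM _))

lemma integrable_evolution_comp (hU : ∀ x, Continuous fun t => U t x) (hM : ∀ t, ‖U t‖ ≤ M)
    {μ : Measure ℝ} {f : ℝ → X} (hf : Integrable f μ) {τ : ℝ → ℝ} (hτ : Continuous τ) :
    Integrable (fun s => U (τ s) (f s)) μ := by
  refine (hf.norm.const_mul M).mono' ?_ (Eventually.of_forall fun s => ?_)
  · exact (continuous_uncurry_of_bounded hU hM).comp_aestronglyMeasurable
      (hτ.aestronglyMeasurable.prodMk hf.aestronglyMeasurable)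
  · exact ((U _).le_opNorm _).trans (by gcongr; exact hM _)

lemma integrable_evolution (hU : ∀ x, Continuous fun t => U t x) (hM : ∀ t, ‖U t‖ ≤ M)
    {μ : Measure ℝ} {f : ℝ → X} (hf : Integrable f μ) (t : ℝ) :
    Integrable (fun s => U (t - s) (f s)) μ :=
  integrable_evolution_comp hU hM hf (continuous_const.sub continuous_id)

lemma continuousOn_convolution (hU : ∀ x, Continuous fun t => U t x) (hM : ∀ t, ‖U t‖ ≤ M)
    {T : ℝ} {f : ℝ → X} (hf : Integrable f (timeMeasure T)) :
    ContinuousOn (fun t => ∫ s in (0 : ℝ)..t, U (t - s) (f s)) (Icc 0 T) := by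
  suffices h : Continuous fun t => ∫ s, (Iio t).indicator (fun s => U (t - s) (f s)) s
      ∂timeMeasure T from
    h.continuousOn.congr fun t ht => intervalIntegral_zero_eq ht _
  rw [continuous_iff_continuousAt]
  intro t₀
  refine continuousAt_of_dominated (bound := fun s => M * ‖f s‖) (Eventually.of_forall fun t =>
    ((integrable_evolution hU hM hf t).indicator measurableSet_Iio).aestronglyMeasurable)
    (Eventually.of_forall fun t => Eventually.of_forall fun s => ?_) (hf.norm.const_mul M) ?_
  · refine (norm_indicator_le_norm_self _ _).trans ?_
    exact ((U _).le_opNorm _).trans (by gcongr; exact hM _)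
  · have hne : ∀ᵐ s ∂timeMeasure T, s ≠ t₀ :=
      ae_restrict_of_ae (by simp [ae_iff])
    filter_upwards [hne] with s hs
    rcases lt_or_gt_of_ne hs with h | h
    · have hc : ContinuousAt (fun t => U (t - s) (f s)) t₀ :=
        ((hU (f s)).comp (continuous_id.sub continuous_const)).continuousAt
      refine hc.congr ?_
      filter_upwards [lt_mem_nhds h] with t ht
      rw [indicator_of_mem (show s ∈ Iio t from ht)]
    · refine (continuousAt_const (y := (0 : X))).congr ?_
      filter_upwards [gt_mem_nhds h] with t ht
      rw [indicator_of_notMem (show s ∉ Iio t from not_lt.2 ht.le)]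

lemma integrable_clm_apply {Y : Type*} [NormedAddCommGroup Y] [NormedSpace ℝ Y]
    {T : ℝ} {B : ℝ → X →L[ℝ] Y}
    (hB : Integrable B (timeMeasure T)) {y : ℝ → X} (hy : ContinuousOn y (Icc 0 T)) :
    Integrable (fun s => B s (y s)) (timeMeasure T) := by
  obtain ⟨c, hc⟩ := isCompact_Icc.exists_bound_of_continuousOn hy
  have hym : AEStronglyMeasurable y (timeMeasure T) :=
    (hy.mono Ioo_subset_Icc_self).aestronglyMeasurable measurableSet_Ioo
  refine (hB.norm.mul_const c).mono' ?_ ?_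
  · exact isBoundedBilinearMap_apply.continuous.comp_aestronglyMeasurable
      (hB.aestronglyMeasurable.prodMk hym)
  · refine (ae_restrict_mem measurableSet_Ioo).mono fun s hs => ?_
    exact ((B s).le_opNorm _).trans (by gcongr; exact hc s (Ioo_subset_Icc_self hs))

lemma integrable_dual_apply {T : ℝ} {φ : ℝ → StrongDual ℝ X} (hφ : ContinuousOn φ (Icc 0 T))
    {h : ℝ → X} (hh : Integrable h (timeMeasure T)) :
    Integrable (fun s => φ s (h s)) (timeMeasure T) := by
  obtain ⟨c, hc⟩ := isCompact_Icc.exists_bound_of_continuousOn hφ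
  have hφm : AEStronglyMeasurable φ (timeMeasure T) :=
    (hφ.mono Ioo_subset_Icc_self).aestronglyMeasurable measurableSet_Ioo
  refine (hh.norm.const_mul c).mono' ?_ ?_
  · exact isBoundedBilinearMap_apply.continuous.comp_aestronglyMeasurable
      (hφm.prodMk hh.aestronglyMeasurable)
  · refine (ae_restrict_mem measurableSet_Ioo).mono fun s hs => ?_
    exact ((φ s).le_opNorm _).trans (by gcongr; exact hc s (Ioo_subset_Icc_self hs))

/-- Solvability of a linear Volterra equation with integrable coefficient. -/
theorem exists_volterra_solution [CompleteSpace X] (hU : ∀ x, Continuous fun t => U t x)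
    (hM : ∀ t, ‖U t‖ ≤ M) {T : ℝ} (hT : 0 ≤ T) {B : ℝ → X →L[ℝ] X}
    (hB : Integrable B (timeMeasure T)) {g : ℝ → X} (hg : ContinuousOn g (Icc 0 T)) :
    ∃ y : ℝ → X, ContinuousOn y (Icc 0 T) ∧
      ∀ t ∈ Icc 0 T, y t = g t + ∫ s in (0 : ℝ)..t, U (t - s) (B s (y s)) := by
  have hM0 : 0 ≤ M := (norm_nonneg _).trans (hM 0)
  obtain ⟨l, hl0, hl⟩ := exists_exp_weight hT hB.norm
    (show (0 : ℝ) < (2 * (M + 1))⁻¹ by positivity)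
  let U' : ℝ → X →L[ℝ] X := fun t => Real.exp (-l * max t 0) • U t
  have hU' : ∀ x, Continuous fun t => U' t x := fun x =>
    (show Continuous fun t : ℝ => Real.exp (-l * max t 0) by fun_prop).smul (hU x)
  have hM'' : ∀ t, ‖U' t‖ ≤ Real.exp (-l * max t 0) * M := fun t => by
    rw [norm_smul, Real.norm_of_nonneg (Real.exp_pos _).le]
    gcongr
    exact hM t
  have hM' : ∀ t, ‖U' t‖ ≤ M := fun t => (hM'' t).trans
    (mul_le_of_le_one_left hM0 (Real.exp_le_one_iff.2 (by
      have := mul_nonneg hl0 (le_max_right t 0)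
      linarith)))
  have hext : ∀ z : C(Icc 0 T, X), Integrable (fun s => B s (IccExtend hT z s)) (timeMeasure T) :=
    fun z => integrable_clm_apply hB (z.continuous.Icc_extend').continuousOn
  let Φ : C(Icc 0 T, X) → C(Icc 0 T, X) := fun z =>
    ⟨fun t => Real.exp (-l * t) • g t + ∫ s in (0 : ℝ)..t, U' (t - s) (B s (IccExtend hT z s)),
      continuousOn_iff_continuous_domRestrict.1
        (((by fun_prop : Continuous fun t : ℝ => Real.exp (-l * t)).continuousOn.smul hg).add
          (continuousOn_convolution hU' hM' (hext z)))⟩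
  have hΦ : ContractingWith (1 / 2) Φ := by
    refine ⟨by norm_num, LipschitzWith.of_dist_le_mul fun z w => ?_⟩
    rw [ContinuousMap.dist_le (by positivity)]
    intro t
    have hint : ∀ z : C(Icc 0 T, X), IntervalIntegrable
        (fun s => U' (t - s) (B s (IccExtend hT z s))) volume 0 t := fun z =>
      ((intervalIntegrable_iff_integrable_timeMeasure hT).2
        (integrable_evolution hU' hM' (hext z) t)).mono_set (by
          rw [uIcc_of_le t.2.1, uIcc_of_le hT]
          exact Icc_subset_Icc_right t.2.2)
    have hBint : IntervalIntegrable (fun s => |‖B s‖|) volume 0 t :=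
      ((intervalIntegrable_iff_integrable_timeMeasure hT).2 hB.norm.abs).mono_set (by
          rw [uIcc_of_le t.2.1, uIcc_of_le hT]
          exact Icc_subset_Icc_right t.2.2)
    have hsub : Φ z t - Φ w t = ∫ s in (0 : ℝ)..t,
        (U' (t - s) (B s (IccExtend hT z s)) - U' (t - s) (B s (IccExtend hT w s))) := by
      rw [intervalIntegral.integral_sub (hint z) (hint w)]
      exact add_sub_add_left_eq_sub _ _ _
    rw [dist_eq_norm, hsub]
    have hexp : Continuous fun s : ℝ => Real.exp (-l * (t - s)) := by fun_prop
    calc ‖∫ s in (0 : ℝ)..t,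
          (U' (t - s) (B s (IccExtend hT z s)) - U' (t - s) (B s (IccExtend hT w s)))‖
        ≤ ∫ s in (0 : ℝ)..t, (M * dist z w) * (Real.exp (-l * (t - s)) * |‖B s‖|) := by
          refine intervalIntegral.norm_integral_le_of_norm_le t.2.1
            (Eventually.of_forall fun s hs => ?_)
            ((hBint.continuousOn_mul hexp.continuousOn).const_mul _)
          rw [← map_sub, ← map_sub, abs_norm]
          have hmax : max ((t : ℝ) - s) 0 = t - s := max_eq_left (by linarith [hs.2])
          have h1 := hM'' (t - s)
          rw [hmax] at h1
          have h2 : ‖IccExtend hT z s - IccExtend hT w s‖ ≤ dist z w := by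
            rw [← dist_eq_norm]
            exact ContinuousMap.dist_apply_le_dist _
          calc _ ≤ ‖U' (t - s)‖ * (‖B s‖ * ‖IccExtend hT z s - IccExtend hT w s‖) :=
                ((U' (t - s)).le_opNorm _).trans (by gcongr; exact (B s).le_opNorm _)
            _ ≤ (Real.exp (-l * (t - s)) * M) * (‖B s‖ * dist z w) := by gcongr
            _ = _ := by ring
      _ = (M * dist z w) * ∫ s in (0 : ℝ)..t, Real.exp (-l * (t - s)) * |‖B s‖| :=
          intervalIntegral.integral_const_mul _ _
      _ ≤ (M * dist z w) * (2 * (M + 1))⁻¹ := by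
          gcongr
          exact hl t t.2
      _ ≤ ((M + 1) * dist z w) * (2 * (M + 1))⁻¹ := by gcongr; linarith
      _ = _ := by
          push_cast
          field_simp
  obtain ⟨z, hz⟩ : ∃ z, Φ z = z := ⟨_, hΦ.fixedPoint_isFixedPt⟩
  refine ⟨fun t => Real.exp (l * t) • IccExtend hT z t,
    ((by fun_prop : Continuous fun t : ℝ => Real.exp (l * t)).smul
      z.continuous.Icc_extend').continuousOn, fun t ht => ?_⟩
  have h1 : IccExtend hT z t = Real.exp (-l * t) • g t +
      ∫ s in (0 : ℝ)..t, U' (t - s) (B s (IccExtend hT z s)) := by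
    rw [IccExtend_of_mem hT z ht]
    exact (DFunLike.congr_fun hz ⟨t, ht⟩).symm
  simp only
  rw [h1, smul_add, smul_smul, ← Real.exp_add, ← intervalIntegral.integral_smul]
  congr 1
  · simp
  · refine intervalIntegral.integral_congr fun s hs => ?_
    rw [uIcc_of_le ht.1] at hs
    simp only [U', max_eq_left (sub_nonneg.2 hs.2), _root_.smul_apply, map_smul,
      smul_smul, ← Real.exp_add]
    congr 2
    ring

end Volterra
end EvolutionControl
namespace EvolutionControl

section SemigroupTheory

variable {X : Type u} [NormedAddCommGroup X] [NormedSpace ℝ X]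

/-- A family of operators on `[0, T]`, extended to `ℝ` by its values at the end points. -/
noncomputable def clampedFamily (S : ℝ → X →L[ℝ] X) (T : ℝ) (t : ℝ) : X →L[ℝ] X :=
  S (max 0 (min T t))

lemma clampedFamily_of_mem (S : ℝ → X →L[ℝ] X) {T t : ℝ} (ht : t ∈ Icc 0 T) :
    clampedFamily S T t = S t := by
  rw [clampedFamily, min_eq_right ht.2, max_eq_right ht.1]

lemma clamp_mem {T : ℝ} (hT : 0 ≤ T) (t : ℝ) : max 0 (min T t) ∈ Icc 0 T :=
  ⟨le_max_left _ _, max_le hT (min_le_left _ _)⟩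

lemma continuous_clampedFamily {S : ℝ → X →L[ℝ] X} {T : ℝ} (hT : 0 ≤ T)
    (hS : ∀ x, ContinuousOn (fun t => S t x) (Icc 0 T)) (x : X) :
    Continuous fun t => clampedFamily S T t x :=
  (hS x).comp_continuous (by fun_prop) (clamp_mem hT)

lemma exists_norm_clampedFamily_le [CompleteSpace X] {S : ℝ → X →L[ℝ] X} {T : ℝ} (hT : 0 ≤ T)
    (hS : ∀ x, ContinuousOn (fun t => S t x) (Icc 0 T)) :
    ∃ M, ∀ t, ‖clampedFamily S T t‖ ≤ M := by
  refine banach_steinhaus fun x => ?_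
  obtain ⟨c, hc⟩ := isCompact_Icc.exists_bound_of_continuousOn (hS x)
  exact ⟨c, fun t => hc _ (clamp_mem hT t)⟩

lemma C0Semigroup.continuousOn_Icc (S : C0Semigroup X) (T : ℝ) (x : X) :
    ContinuousOn (fun t => S t x) (Icc 0 T) :=
  (S.continuousOn' x).mono Icc_subset_Ici_self

/-- Volterra equations whose kernel is strongly continuous on `[0, T]` are solvable. -/
theorem exists_mild_solution_of_family [CompleteSpace X] {S : ℝ → X →L[ℝ] X} {T : ℝ} (hT : 0 ≤ T)
    (hS : ∀ x, ContinuousOn (fun t => S t x) (Icc 0 T)) {B : ℝ → X →L[ℝ] X}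
    (hB : Integrable B (timeMeasure T)) {f : ℝ → X} (hf : Integrable f (timeMeasure T)) (y₀ : X) :
    ∃ y : ℝ → X, ContinuousOn y (Icc 0 T) ∧ Integrable (fun s => B s (y s)) (timeMeasure T) ∧
      ∀ t ∈ Icc 0 T, y t = S t y₀ + ∫ s in (0 : ℝ)..t, S (t - s) (B s (y s) + f s) := by
  obtain ⟨M, hM⟩ := exists_norm_clampedFamily_le hT hS
  have hU := continuous_clampedFamily hT hS
  obtain ⟨y, hyc, hy⟩ := exists_volterra_solution hU hM hT hB
    ((hS y₀).add (continuousOn_convolution hU hM hf))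
  have hBy := integrable_clm_apply hB hyc
  refine ⟨y, hyc, hBy, fun t ht => ?_⟩
  have hint : ∀ {h : ℝ → X}, Integrable h (timeMeasure T) →
      IntervalIntegrable (fun s => clampedFamily S T (t - s) (h s)) volume 0 t := fun hh =>
    ((intervalIntegrable_iff_integrable_timeMeasure hT).2
      (integrable_evolution hU hM hh t)).mono_set (by
        rw [uIcc_of_le ht.1, uIcc_of_le hT]
        exact Icc_subset_Icc_right ht.2)
  rw [hy t ht, Pi.add_apply, add_assoc, ← intervalIntegral.integral_add (hint hf) (hint hBy)]
  congr 1
  refine intervalIntegral.integral_congr fun s hs => ?_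
  rw [uIcc_of_le ht.1] at hs
  have hts : t - s ∈ Icc 0 T := ⟨sub_nonneg.2 hs.2, by linarith [hs.1, ht.2]⟩
  simp only [clampedFamily_of_mem S hts, map_add]
  abel

theorem exists_isMildSolution [CompleteSpace X] (S : C0Semigroup X) {T : ℝ} (hT : 0 ≤ T)
    {B : ℝ → X →L[ℝ] X} (hB : Integrable B (timeMeasure T)) {f : ℝ → X}
    (hf : Integrable f (timeMeasure T)) (y₀ : X) :
    ∃ y : ℝ → X, IsMildSolution S T (fun t z => B t z + f t) y₀ y := by
  obtain ⟨y, hyc, hBy, hy⟩ := exists_mild_solution_of_family hT (S.continuousOn_Icc T) hB hf y₀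
  exact ⟨y, hyc, (intervalIntegrable_iff_integrable_timeMeasure hT).2 (hBy.add hf), hy⟩

theorem exists_mild_solution_of_family_of_clm [CompleteSpace X] {Z : Type*} [NormedAddCommGroup Z]
    [NormedSpace ℝ Z] (Λ : Z →L[ℝ] X →L[ℝ] X) {S : ℝ → X →L[ℝ] X} {T : ℝ} (hT : 0 ≤ T)
    (hS : ∀ x, ContinuousOn (fun t => S t x) (Icc 0 T)) {B : ℝ → Z}
    (hB : Integrable B (timeMeasure T)) (y₀ : X) :
    ∃ y : ℝ → X, ContinuousOn y (Icc 0 T) ∧ Integrable (fun s => Λ (B s) (y s)) (timeMeasure T) ∧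
      ∀ t ∈ Icc 0 T, y t = S t y₀ + ∫ s in (0 : ℝ)..t, S (t - s) (Λ (B s) (y s)) := by
  simpa using exists_mild_solution_of_family hT hS (Λ.integrable_comp hB)
    (integrable_zero ℝ X (timeMeasure T)) y₀

end SemigroupTheory

section DualSemigroup

variable {X : Type u} [NormedAddCommGroup X] [InnerProductSpace ℝ X] [CompleteSpace X]

omit [CompleteSpace X] in
lemma norm_dualOp_le (L : X →L[ℝ] X) : ‖dualOp L‖ ≤ ‖L‖ :=
  ContinuousLinearMap.opNorm_le_bound _ (norm_nonneg _) fun φ => by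
    rw [mul_comm]
    exact φ.opNorm_comp_le L

lemma exists_eval_of_bidual (Ψ : StrongDual ℝ (StrongDual ℝ X)) :
    ∃ z : X, ∀ φ : StrongDual ℝ X, Ψ φ = φ z := by
  let ρ : StrongDual ℝ X :=
    Ψ.comp (InnerProductSpace.toDual ℝ X).toContinuousLinearEquiv.toContinuousLinearMap
  refine ⟨(InnerProductSpace.toDual ℝ X).symm ρ, fun φ => ?_⟩
  obtain ⟨x, rfl⟩ := (InnerProductSpace.toDual ℝ X).surjective φ
  rw [InnerProductSpace.toDual_apply_apply, real_inner_comm, InnerProductSpace.toDual_symm_apply]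
  rfl

omit [CompleteSpace X] in
/-- The functional `z ↦ ∫₀ʳ φ(U(s) z) ds`. -/
lemma exists_integral_functional {U : ℝ → X →L[ℝ] X} {M : ℝ}
    (hU : ∀ x, Continuous fun t => U t x) (hM : ∀ t, ‖U t‖ ≤ M) (φ : StrongDual ℝ X) (r : ℝ) :
    ∃ ψ : StrongDual ℝ X, ∀ z, ψ z = ∫ s in (0 : ℝ)..r, φ (U s z) := by
  have hc : ∀ z, Continuous fun s => φ (U s z) := fun z => φ.continuous.comp (hU z)
  let ψ : X →ₗ[ℝ] ℝ :=
    { toFun := fun z => ∫ s in (0 : ℝ)..r, φ (U s z)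
      map_add' := fun x y => by
        simp only [map_add]
        exact intervalIntegral.integral_add ((hc x).intervalIntegrable _ _)
          ((hc y).intervalIntegrable _ _)
      map_smul' := fun c x => by
        simp only [map_smul]
        exact intervalIntegral.integral_smul c _ }
  refine ⟨ψ.mkContinuous (‖φ‖ * M * |r - 0|) fun z => ?_, fun z => rfl⟩
  refine (intervalIntegral.norm_integral_le_of_norm_le_const (C := ‖φ‖ * (M * ‖z‖))
    fun s _ => ?_).trans_eq (by ring)
  exact (φ.le_opNorm _).trans (by gcongr; exact (U s).le_of_opNorm_le (hM s) z)

/-- In a Hilbert space the adjoint semigroup is right continuous at `0`. -/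
lemma tendsto_dualOp_semigroup (S : C0Semigroup X) (φ : StrongDual ℝ X) :
    Tendsto (fun h => dualOp (S h) φ) (𝓝[≥] 0) (𝓝 φ) := by
  set U := clampedFamily S 2 with hUdef
  obtain ⟨M, hM⟩ := exists_norm_clampedFamily_le zero_le_two (S.continuousOn_Icc 2)
  have hU := continuous_clampedFamily zero_le_two (S.continuousOn_Icc 2)
  rw [← hUdef] at hM hU
  have hM0 : 0 ≤ M := (norm_nonneg _).trans (hM 0)
  have hUS : ∀ t ∈ Icc (0 : ℝ) 2, U t = S t := fun t ht => clampedFamily_of_mem S ht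
  have hI : Icc (0 : ℝ) 1 ∈ 𝓝[≥] (0 : ℝ) := Icc_mem_nhdsGE zero_lt_one
  have hdual : ∀ h ∈ Icc (0 : ℝ) 1, ‖dualOp (S h)‖ ≤ M := fun h hh =>
    (norm_dualOp_le _).trans (by
      rw [← hUS h ⟨hh.1, by linarith [hh.2]⟩]; exact hM h)
  let E : Submodule ℝ (StrongDual ℝ X) :=
    { carrier := {φ | Tendsto (fun h => dualOp (S h) φ) (𝓝[≥] 0) (𝓝 φ)}
      add_mem' := fun {a b} ha hb => by
        simpa only [mem_ofPred_eq, map_add] using Tendsto.add ha hb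
      zero_mem' := by simpa only [mem_ofPred_eq, map_zero] using tendsto_const_nhds
      smul_mem' := fun c a ha => by
        simpa only [mem_ofPred_eq, map_smul] using Tendsto.const_smul ha c }
  have hEclosed : IsClosed (E : Set (StrongDual ℝ X)) := by
    refine isClosed_of_closure_subset fun ψ hψ => ?_
    change Tendsto (fun h => dualOp (S h) ψ) (𝓝[≥] 0) (𝓝 ψ)
    rw [Metric.tendsto_nhds]
    intro ε hε
    obtain ⟨χ, hχ, hd⟩ := Metric.mem_closure_iff.1 hψ (ε / (2 * (M + 1))) (by positivity)
    have hχ' : Tendsto (fun h => dualOp (S h) χ) (𝓝[≥] 0) (𝓝 χ) := hχ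
    filter_upwards [Metric.tendsto_nhds.1 hχ' (ε / 2) (half_pos hε), hI] with h h1 h2
    rw [dist_eq_norm] at *
    have h3 : dualOp (S h) ψ - ψ =
        dualOp (S h) (ψ - χ) + (dualOp (S h) χ - χ) - (ψ - χ) := by
      rw [map_sub]; abel
    have h4 : ‖dualOp (S h) (ψ - χ)‖ ≤ M * ‖ψ - χ‖ :=
      ContinuousLinearMap.le_of_opNorm_le _ (hdual h h2) _
    have h5 : (M + 1) * ‖ψ - χ‖ < ε / 2 := by
      calc _ < (M + 1) * (ε / (2 * (M + 1))) := by gcongr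
        _ = ε / 2 := by field_simp
    rw [h3]
    have h6 := norm_sub_le (dualOp (S h) (ψ - χ) + (dualOp (S h) χ - χ)) (ψ - χ)
    have h7 := norm_add_le (dualOp (S h) (ψ - χ)) (dualOp (S h) χ - χ)
    linarith
  have hint : ∀ r ∈ Icc (0 : ℝ) 1, ∀ ψ : StrongDual ℝ X,
      (∀ z, ψ z = ∫ s in (0 : ℝ)..r, φ (U s z)) → ψ ∈ E := by
    intro r hr ψ hψ
    change Tendsto (fun h => dualOp (S h) ψ) (𝓝[≥] 0) (𝓝 ψ)
    rw [tendsto_iff_norm_sub_tendsto_zero]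
    have hlim : Tendsto (fun h : ℝ => ‖φ‖ * M * (2 * h)) (𝓝[≥] 0) (𝓝 0) := by
      have : Continuous fun h : ℝ => ‖φ‖ * M * (2 * h) := by fun_prop
      simpa using (this.tendsto 0).mono_left nhdsWithin_le_nhds
    refine squeeze_zero' (Eventually.of_forall fun _ => norm_nonneg _) ?_ hlim
    filter_upwards [hI] with h hh
    have hh0 := hh.1
    refine ContinuousLinearMap.opNorm_le_bound _ (by positivity) fun z => ?_
    have hc : Continuous fun s => φ (U s z) := φ.continuous.comp (hU z)
    have h1 : ψ (S h z) = ∫ s in h..(r + h), φ (U s z) := by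
      have hshift := intervalIntegral.integral_comp_add_right (a := 0) (b := r)
        (fun s => φ (U s z)) h
      rw [zero_add] at hshift
      rw [hψ, ← hshift]
      refine intervalIntegral.integral_congr fun s hs => ?_
      rw [uIcc_of_le hr.1] at hs
      rw [hUS s ⟨hs.1, by linarith [hs.2, hr.2]⟩,
        hUS (s + h) ⟨by linarith [hs.1], by linarith [hs.2, hr.2, hh.2]⟩, S.map_add' s h hs.1 hh0]
      rfl
    have h2 : (∫ s in h..(r + h), φ (U s z)) - ∫ s in (0 : ℝ)..r, φ (U s z) =
        (∫ s in r..(r + h), φ (U s z)) - ∫ s in (0 : ℝ)..h, φ (U s z) := by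
      have hi : ∀ a b : ℝ, IntervalIntegrable (fun s => φ (U s z)) volume a b :=
        fun a b => hc.intervalIntegrable a b
      have e1 := intervalIntegral.integral_add_adjacent_intervals (hi 0 h) (hi h (r + h))
      have e2 := intervalIntegral.integral_add_adjacent_intervals (hi 0 r) (hi r (r + h))
      linarith
    have hb : ∀ a b : ℝ, ‖∫ s in a..b, φ (U s z)‖ ≤ ‖φ‖ * (M * ‖z‖) * |b - a| := fun a b =>
      intervalIntegral.norm_integral_le_of_norm_le_const fun s _ =>
        (φ.le_opNorm _).trans (by gcongr; exact (U s).le_of_opNorm_le (hM s) z)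
    have b1 := hb r (r + h)
    have b2 := hb 0 h
    rw [add_sub_cancel_left, abs_of_nonneg hh0] at b1
    rw [sub_zero, abs_of_nonneg hh0] at b2
    rw [_root_.sub_apply, dualOp_apply, h1, hψ, h2]
    exact (norm_sub_le _ _).trans ((add_le_add b1 b2).trans_eq (by ring))
  by_contra hφ
  obtain ⟨Ψ, c, hΨ, hc⟩ := geometric_hahn_banach_closed_point E.convex hEclosed
    (show φ ∉ (E : Set (StrongDual ℝ X)) from hφ)
  have hc0 : 0 < c := by simpa using hΨ 0 E.zero_mem
  have hΨ0 : ∀ ψ ∈ E, Ψ ψ = 0 := by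
    intro ψ hψ
    by_contra hne
    have := hΨ _ (E.smul_mem (c / Ψ ψ) hψ)
    rw [map_smul, smul_eq_mul, div_mul_cancel₀ _ hne] at this
    exact lt_irrefl _ this
  obtain ⟨z, hz⟩ := exists_eval_of_bidual Ψ
  have hcont : Continuous fun s => φ (U s z) := φ.continuous.comp (hU z)
  have hF : ∀ r ∈ Icc (0 : ℝ) 1, ∫ s in (0 : ℝ)..r, φ (U s z) = 0 := by
    intro r hr
    obtain ⟨ψ, hψ⟩ := exists_integral_functional hU hM φ r
    rw [← hψ, ← hz]
    exact hΨ0 ψ (hint r hr ψ hψ)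
  have hd1 : HasDerivWithinAt (fun r => ∫ s in (0 : ℝ)..r, φ (U s z)) (φ (U 0 z)) (Ici 0) 0 :=
    (hcont.integral_hasStrictDerivAt 0 0).hasDerivAt.hasDerivWithinAt
  have hd2 : HasDerivWithinAt (fun r => ∫ s in (0 : ℝ)..r, φ (U s z)) 0 (Ici 0) 0 :=
    (hasDerivWithinAt_const 0 (Ici 0) (0 : ℝ)).congr_of_eventuallyEq
      (by filter_upwards [hI] with r hr using hF r hr) (hF 0 (by simp))
  have h0 := (uniqueDiffWithinAt_Ici (0 : ℝ)).eq_deriv _ hd1 hd2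
  rw [hUS 0 (by simp), S.map_zero'] at h0
  rw [hz φ] at hc
  have : φ z = 0 := h0
  linarith

lemma continuousOn_dualOp_semigroup (S : C0Semigroup X) {T : ℝ} (hT : 0 ≤ T)
    (φ : StrongDual ℝ X) : ContinuousOn (fun t => dualOp (S t) φ) (Icc 0 T) := by
  obtain ⟨M, hM⟩ := exists_norm_clampedFamily_le hT (S.continuousOn_Icc T)
  have hM0 : 0 ≤ M := (norm_nonneg _).trans (hM 0)
  rw [Metric.continuousOn_iff]
  intro t ht ε hε
  have h := tendsto_dualOp_semigroup S φ
  rw [Metric.tendsto_nhdsWithin_nhds] at h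
  obtain ⟨δ, hδ, hd⟩ := h (ε / (M + 1)) (by positivity)
  have key : ∀ a ∈ Icc 0 T, ∀ b ∈ Icc 0 T, a ≤ b → dist b a < δ →
      dist (dualOp (S b) φ) (dualOp (S a) φ) < ε := by
    intro a ha b hb hab hlt
    have hba : 0 ≤ b - a := sub_nonneg.2 hab
    have h1 : dualOp (S b) φ - dualOp (S a) φ = dualOp (S a) (dualOp (S (b - a)) φ - φ) := by
      have := S.map_add' (b - a) a hba ha.1
      rw [sub_add_cancel] at this
      rw [map_sub]
      congr 1
      ext x
      simp [this]
    have h2 := hd (x := b - a) hba (by simpa [Real.dist_eq] using hlt)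
    rw [dist_eq_norm] at h2 ⊢
    rw [h1]
    have h3 : ‖dualOp (S a)‖ ≤ M := (norm_dualOp_le _).trans (by
      rw [← clampedFamily_of_mem S ha]; exact hM a)
    calc _ ≤ ‖dualOp (S a)‖ * ‖dualOp (S (b - a)) φ - φ‖ := ContinuousLinearMap.le_opNorm _ _
      _ ≤ (M + 1) * ‖dualOp (S (b - a)) φ - φ‖ := by gcongr; linarith
      _ < (M + 1) * (ε / (M + 1)) := by gcongr
      _ = ε := by field_simp
  refine ⟨δ, hδ, fun s hs hst => ?_⟩
  rcases le_total t s with h | h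
  · exact key t ht s hs h hst
  · rw [dist_comm] at hst ⊢
    exact key s hs t ht h hst

theorem exists_isAdjointMildSolution (S : C0Semigroup X) {T : ℝ} (hT : 0 ≤ T)
    {B : ℝ → X →L[ℝ] X} (hB : Integrable B (timeMeasure T)) (φT : StrongDual ℝ X) :
    ∃ φ : ℝ → StrongDual ℝ X, IsAdjointMildSolution S T B φT φ := by
  have hrev : MeasurePreserving (fun s : ℝ => T - s) (timeMeasure T) (timeMeasure T) := by
    have h := (Measure.measurePreserving_sub_left (volume : Measure ℝ) T).restrict_preimage
      (measurableSet_Ioo (a := (0 : ℝ)) (b := T))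
    have : (fun s : ℝ => T - s) ⁻¹' Ioo 0 T = Ioo 0 T := by simp
    rwa [this] at h
  have hB' : Integrable (fun s => B (T - s)) (timeMeasure T) :=
    hrev.integrable_comp_of_integrable hB
  obtain ⟨ψ, hψc, hψi, hψ⟩ := exists_mild_solution_of_family_of_clm
    (ContinuousLinearMap.compL ℝ X X ℝ).flip hT
    (S := fun t => dualOp (S t)) (continuousOn_dualOp_semigroup S hT) hB' φT
  have hmaps : MapsTo (fun t => T - t) (Icc 0 T) (Icc 0 T) := fun t ht =>
    ⟨by linarith [ht.2], by linarith [ht.1]⟩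
  refine ⟨fun t => ψ (T - t), hψc.comp (by fun_prop) hmaps,
    (intervalIntegrable_iff_integrable_timeMeasure hT).2 ?_, fun t ht => ?_⟩
  · have := hrev.integrable_comp_of_integrable hψi
    simp only [Function.comp_def, sub_sub_cancel] at this
    exact this
  · have h := intervalIntegral.integral_comp_sub_left (a := t) (b := T)
      (fun s => dualOp (S (T - t - s)) (dualOp (B (T - s)) (ψ s))) T
    simp only [sub_self, sub_sub_cancel, sub_sub_sub_cancel_left] at h
    rw [hψ _ (hmaps ht), h]
    rfl

end DualSemigroup
end EvolutionControl
namespace EvolutionControl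

section Duality

variable {X : Type u} [NormedAddCommGroup X] [NormedSpace ℝ X]

lemma integrable_triangle_kernel {U : ℝ → X →L[ℝ] X} {M : ℝ}
    (hU : ∀ x, Continuous fun t => U t x) (hM : ∀ t, ‖U t‖ ≤ M) {μ : Measure ℝ} [SFinite μ]
    {F : ℝ → X} (hF : Integrable F μ) {g : ℝ → StrongDual ℝ X} (hg : Integrable g μ) :
    Integrable (fun p : ℝ × ℝ => {q : ℝ × ℝ | q.1 < q.2}.indicator
      (fun q => g q.2 (U (q.2 - q.1) (F q.1))) p) (μ.prod μ) := by
  have hM0 : 0 ≤ M := (norm_nonneg _).trans (hM 0)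
  refine Integrable.indicator ?_ (measurableSet_lt measurable_fst measurable_snd)
  refine ((hF.norm.mul_prod hg.norm).const_mul M).mono' ?_ (Eventually.of_forall fun p => ?_)
  · have h1 : AEStronglyMeasurable (fun q : ℝ × ℝ => U (q.2 - q.1) (F q.1)) (μ.prod μ) :=
      (continuous_uncurry_of_bounded hU hM).comp_aestronglyMeasurable
        ((continuous_snd.sub continuous_fst).aestronglyMeasurable.prodMk
          hF.aestronglyMeasurable.comp_fst)
    exact isBoundedBilinearMap_apply.continuous.comp_aestronglyMeasurable
      (hg.aestronglyMeasurable.comp_snd.prodMk h1)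
  · calc ‖g p.2 (U (p.2 - p.1) (F p.1))‖ ≤ ‖g p.2‖ * (M * ‖F p.1‖) :=
          ((g p.2).le_opNorm _).trans (by gcongr; exact (U _).le_of_opNorm_le (hM _) _)
      _ = M * (‖F p.1‖ * ‖g p.2‖) := by ring

/-- Integral form of the duality pairing between a linear evolution equation and its adjoint. -/
theorem apply_mildSolution_eq_integral {X : Type u} [NormedAddCommGroup X] [InnerProductSpace ℝ X]
    [CompleteSpace X] {S : C0Semigroup X} {T : ℝ} (hT : 0 ≤ T) {B : ℝ → X →L[ℝ] X}
    {f : ℝ → X} (hf : Integrable f (timeMeasure T)) {ξ : ℝ → X}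
    (hξ : IsMildSolution S T (fun t z => B t z + f t) 0 ξ) {φT : StrongDual ℝ X}
    {φ : ℝ → StrongDual ℝ X} (hφ : IsAdjointMildSolution S T B φT φ) :
    φT (ξ T) = ∫ t, φ t (f t) ∂timeMeasure T := by
  obtain ⟨M, hM⟩ := exists_norm_clampedFamily_le hT (S.continuousOn_Icc T)
  have hU := continuous_clampedFamily hT (S.continuousOn_Icc T)
  have hU' := continuous_clampedFamily hT (continuousOn_dualOp_semigroup S hT)
  obtain ⟨M', hM'⟩ := exists_norm_clampedFamily_le hT (continuousOn_dualOp_semigroup S hT)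
  set U := clampedFamily S T
  have hUS : ∀ t ∈ Icc 0 T, U t = S t := fun t ht => clampedFamily_of_mem S ht
  set F : ℝ → X := fun s => B s (ξ s) + f s with hFdef
  set g : ℝ → StrongDual ℝ X := fun s => dualOp (B s) (φ s) with hgdef
  have hF : Integrable F (timeMeasure T) :=
    (intervalIntegrable_iff_integrable_timeMeasure hT).1 hξ.intervalIntegrable
  have hg : Integrable g (timeMeasure T) :=
    (intervalIntegrable_iff_integrable_timeMeasure hT).1 hφ.intervalIntegrable
  have hmem : ∀ᵐ s ∂timeMeasure T, s ∈ Ioo 0 T := ae_restrict_mem measurableSet_Ioo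
  have hTmem : T ∈ Icc 0 T := ⟨hT, le_rfl⟩
  have : IsFiniteMeasure (timeMeasure T) := by unfold timeMeasure; infer_instance
  have hK := integrable_triangle_kernel hU hM hF hg
  set K : ℝ × ℝ → ℝ := {q : ℝ × ℝ | q.1 < q.2}.indicator
      (fun q => g q.2 (U (q.2 - q.1) (F q.1))) with hKdef
  have hξeq : ∀ t ∈ Icc 0 T, ξ t = ∫ s, (Iio t).indicator (fun s => U (t - s) (F s)) s
      ∂timeMeasure T := by
    intro t ht
    rw [hξ.eq t ht, map_zero, zero_add, ← intervalIntegral_zero_eq ht]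
    refine intervalIntegral.integral_congr fun s hs => ?_
    rw [uIcc_of_le ht.1] at hs
    simp only [hUS _ (⟨sub_nonneg.2 hs.2, by linarith [hs.1, ht.2]⟩ : t - s ∈ Icc 0 T), hFdef]
  have hinner1 : ∀ᵐ s ∂timeMeasure T, φ s (F s) =
      φT (U (T - s) (F s)) + ∫ r, K (s, r) ∂timeMeasure T := by
    filter_upwards [hmem] with s hs
    have hs' := Ioo_subset_Icc_self hs
    have hint : Integrable (fun r => (Ioi s).indicator
        (fun r => clampedFamily (fun t => dualOp (S t)) T (r - s) (g r)) r) (timeMeasure T) :=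
      (integrable_evolution_comp hU' hM' hg (continuous_id.sub continuous_const)).indicator
        measurableSet_Ioi
    have hφs : φ s = dualOp (S (T - s)) φT + ∫ r, (Ioi s).indicator
        (fun r => clampedFamily (fun t => dualOp (S t)) T (r - s) (g r)) r ∂timeMeasure T := by
      rw [hφ.eq s hs', ← intervalIntegral_end_eq hs']
      congr 1
      refine intervalIntegral.integral_congr fun r hr => ?_
      rw [uIcc_of_le hs'.2] at hr
      have hr' : r - s ∈ Icc 0 T := ⟨sub_nonneg.2 hr.1, by linarith [hr.2, hs'.1]⟩
      simp only [clampedFamily_of_mem _ hr', hgdef]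
    rw [hφs, _root_.add_apply, ContinuousLinearMap.integral_apply hint]
    congr 1
    · rw [hUS _ (⟨by linarith [hs.2], by linarith [hs.1]⟩ : T - s ∈ Icc 0 T)]
      rfl
    · refine integral_congr_ae ?_
      filter_upwards [hmem] with r hr
      by_cases hsr : s < r
      · rw [indicator_of_mem (show r ∈ Ioi s from hsr), hKdef,
          indicator_of_mem (show (s, r) ∈ {q : ℝ × ℝ | q.1 < q.2} from hsr)]
        rfl
      · rw [indicator_of_notMem (show r ∉ Ioi s from hsr), hKdef,
          indicator_of_notMem (show (s, r) ∉ {q : ℝ × ℝ | q.1 < q.2} from hsr)]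
        rfl
  have hinner2 : ∀ᵐ r ∂timeMeasure T, ∫ s, K (s, r) ∂timeMeasure T = φ r (B r (ξ r)) := by
    filter_upwards [hmem] with r hr
    change _ = g r (ξ r)
    rw [hξeq r (Ioo_subset_Icc_self hr), ← ContinuousLinearMap.integral_comp_comm _
      ((integrable_evolution hU hM hF r).indicator measurableSet_Iio)]
    refine integral_congr_ae (Eventually.of_forall fun s => ?_)
    by_cases hsr : s < r
    · simp only [hKdef]
      rw [indicator_of_mem (show s ∈ Iio r from hsr),
        indicator_of_mem (show (s, r) ∈ {q : ℝ × ℝ | q.1 < q.2} from hsr)]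
    · simp only [hKdef]
      rw [indicator_of_notMem (show s ∉ Iio r from hsr),
        indicator_of_notMem (show (s, r) ∉ {q : ℝ × ℝ | q.1 < q.2} from hsr), map_zero]
  have hswap : ∫ s, ∫ r, K (s, r) ∂timeMeasure T ∂timeMeasure T =
      ∫ r, ∫ s, K (s, r) ∂timeMeasure T ∂timeMeasure T := integral_integral_swap hK
  have hUF : Integrable (fun s => φT (U (T - s) (F s))) (timeMeasure T) :=
    φT.integrable_comp (integrable_evolution hU hM hF T)
  have hend : φT (ξ T) = ∫ s, φT (U (T - s) (F s)) ∂timeMeasure T := by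
    rw [hξeq T hTmem, ← ContinuousLinearMap.integral_comp_comm _
      ((integrable_evolution hU hM hF T).indicator measurableSet_Iio)]
    refine integral_congr_ae ?_
    filter_upwards [hmem] with s hs
    rw [indicator_of_mem (show s ∈ Iio T from hs.2)]
  have hφf := integrable_dual_apply hφ.continuousOn hf
  have hφF := integrable_dual_apply hφ.continuousOn hF
  have hφB : Integrable (fun s => φ s (B s (ξ s))) (timeMeasure T) :=
    (hφF.sub hφf).congr (Eventually.of_forall fun s => by simp [hFdef])
  have e1 := integral_congr_ae hinner1
  rw [integral_add hUF hK.integral_prod_left, hswap, integral_congr_ae hinner2, ← hend] at e1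
  have e2 : ∫ s, φ s (F s) ∂timeMeasure T =
      (∫ s, φ s (B s (ξ s)) ∂timeMeasure T) + ∫ s, φ s (f s) ∂timeMeasure T := by
    rw [← integral_add hφB hφf]
    simp only [hFdef, map_add]
  linarith

end Duality
end EvolutionControl
namespace EvolutionControl

section ControlOperator

variable {X : Type u} [NormedAddCommGroup X] [InnerProductSpace ℝ X] [CompleteSpace X]
  {V : Type v} [NormedAddCommGroup V] [InnerProductSpace ℝ V] [CompleteSpace V]

omit [CompleteSpace X] [CompleteSpace V] in
lemma integrable_control {T : ℝ} {D : ℝ → V →L[ℝ] X} (hD : MemLp D 2 (timeMeasure T))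
    {v : ℝ → V} (hv : MemLp v 2 (timeMeasure T)) :
    Integrable (fun t => D t (v t)) (timeMeasure T) := by
  refine (hD.norm.integrable_mul hv.norm).mono' ?_ (Eventually.of_forall fun t => ?_)
  · exact isBoundedBilinearMap_apply.continuous.comp_aestronglyMeasurable
      (hD.aestronglyMeasurable.prodMk hv.aestronglyMeasurable)
  · exact (D t).le_opNorm _

omit [CompleteSpace X] [CompleteSpace V] in
lemma memLp_dualOp_apply {T : ℝ} {D : ℝ → V →L[ℝ] X} (hD : MemLp D 2 (timeMeasure T))
    {φ : ℝ → StrongDual ℝ X} (hφ : ContinuousOn φ (Icc 0 T)) :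
    MemLp (fun t => dualOp (D t) (φ t)) 2 (timeMeasure T) := by
  obtain ⟨c, hc⟩ := isCompact_Icc.exists_bound_of_continuousOn hφ
  have hφm : AEStronglyMeasurable φ (timeMeasure T) :=
    (hφ.mono Ioo_subset_Icc_self).aestronglyMeasurable measurableSet_Ioo
  refine (hD.norm.const_mul c).mono' ?_ ?_
  · exact isBoundedBilinearMap_comp.continuous.comp_aestronglyMeasurable
      (hφm.prodMk hD.aestronglyMeasurable)
  · refine (ae_restrict_mem measurableSet_Ioo).mono fun s hs => ?_
    exact ((φ s).opNorm_comp_le (D s)).trans (by gcongr; exact hc s (Ioo_subset_Icc_self hs))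

/-- The end point map `v ↦ ξ(T; v)` as a bounded operator, with its adjoint. -/
theorem exists_endpoint_operator (S : C0Semigroup X) {T : ℝ} (hT : 0 ≤ T) {B : ℝ → X →L[ℝ] X}
    (hB : Integrable B (timeMeasure T)) {D : ℝ → V →L[ℝ] X} (hD : MemLp D 2 (timeMeasure T)) :
    ∃ L : Lp V 2 (timeMeasure T) →L[ℝ] X,
      reachableSet S T B D = L '' Metric.closedBall 0 1 ∧
      ∀ φT φ, IsAdjointMildSolution S T B φT φ →
        ‖dualOp L φT‖ = lpNorm (fun t => dualOp (D t) (φ t)) 2 (timeMeasure T) := by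
  have hDv : ∀ v : Lp V 2 (timeMeasure T), Integrable (fun t => D t (v t)) (timeMeasure T) :=
    fun v => integrable_control hD (Lp.memLp v)
  have hex : ∀ v : Lp V 2 (timeMeasure T), ∃ ξ : ℝ → X,
      IsMildSolution S T (fun t z => B t z + D t (v t)) 0 ξ :=
    fun v => exists_isMildSolution S hT hB (hDv v) 0
  choose ξ hξ using hex
  have hrep : ∀ φT φ, IsAdjointMildSolution S T B φT φ →
      ∃ G : Lp V 2 (timeMeasure T),
        ‖G‖ = lpNorm (fun t => dualOp (D t) (φ t)) 2 (timeMeasure T) ∧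
        ∀ (v : Lp V 2 (timeMeasure T)) (η : ℝ → X),
          IsMildSolution S T (fun t z => B t z + D t (v t)) 0 η → φT (η T) = inner ℝ G v := by
    intro φT φ hφ
    have hg := memLp_dualOp_apply hD hφ.continuousOn
    have hr : MemLp (fun t => (InnerProductSpace.toDual ℝ V).symm (dualOp (D t) (φ t))) 2
        (timeMeasure T) := by
      refine hg.of_le ((InnerProductSpace.toDual ℝ V).symm.continuous.comp_aestronglyMeasurable
        hg.aestronglyMeasurable) (Eventually.of_forall fun t => ?_)
      rw [LinearIsometryEquiv.norm_map]
    refine ⟨hr.toLp _, ?_, fun v η hη => ?_⟩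
    · rw [Lp.norm_toLp, ← toReal_eLpNorm hg.aestronglyMeasurable]
      congr 1
      exact eLpNorm_congr_norm_ae (Eventually.of_forall fun t => by
        rw [LinearIsometryEquiv.norm_map])
    · rw [apply_mildSolution_eq_integral hT (hDv v) hη hφ, L2.inner_def]
      refine integral_congr_ae ?_
      filter_upwards [hr.coeFn_toLp] with t ht
      rw [ht, InnerProductSpace.toDual_symm_apply]
      rfl
  have hext : ∀ x y : X, (∀ φT : StrongDual ℝ X, φT x = φT y) → x = y := fun x y h =>
    ext_inner_left ℝ fun z => h (innerSL ℝ z)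
  have huniq : ∀ (v : Lp V 2 (timeMeasure T)) (x : X),
      (∀ φT φ, IsAdjointMildSolution S T B φT φ → φT x = φT (ξ v T)) → x = ξ v T :=
    fun v x h => hext _ _ fun φT => by
      obtain ⟨φ, hφ⟩ := exists_isAdjointMildSolution S hT hB φT
      exact h φT φ hφ
  let L₀ : Lp V 2 (timeMeasure T) →ₗ[ℝ] X :=
    { toFun := fun v => ξ v T
      map_add' := fun v w => (huniq _ _ fun φT φ hφ => by
        obtain ⟨G, -, hG⟩ := hrep φT φ hφ
        rw [map_add, hG _ _ (hξ v), hG _ _ (hξ w), hG _ _ (hξ (v + w)), inner_add_right]).symm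
      map_smul' := fun c v => (huniq _ _ fun φT φ hφ => by
        obtain ⟨G, -, hG⟩ := hrep φT φ hφ
        rw [map_smul, RingHom.id_apply, hG _ _ (hξ v), hG _ _ (hξ (c • v)), inner_smul_right,
          smul_eq_mul]).symm }
  have hL₀ : ∀ v, L₀ v = ξ v T := fun _ => rfl
  let L : Lp V 2 (timeMeasure T) →L[ℝ] X := .ofSeqClosedGraph (g := L₀) fun u v x hu hx => by
    refine huniq v x fun φT φ hφ => ?_
    obtain ⟨G, -, hG⟩ := hrep φT φ hφ
    rw [hG _ _ (hξ v)]
    refine tendsto_nhds_unique ((φT.continuous.tendsto x).comp hx) ?_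
    refine (((innerSL ℝ G).continuous.tendsto v).comp hu).congr fun n => ?_
    exact (hG _ _ (hξ (u n))).symm
  have hL : ∀ v, L v = ξ v T := fun _ => rfl
  refine ⟨L, ?_, fun φT φ hφ => ?_⟩
  · ext x
    constructor
    · rintro ⟨v, hv, η, hη, rfl⟩
      refine ⟨v, by simpa using hv, ((huniq v (η T) fun φT φ hφ => ?_).trans (hL v).symm).symm⟩
      obtain ⟨G, -, hG⟩ := hrep φT φ hφ
      rw [hG _ _ hη, hG _ _ (hξ v)]
    · rintro ⟨v, hv, rfl⟩
      exact ⟨v, by simpa using hv, ξ v, hξ v, rfl⟩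
  · obtain ⟨G, hGn, hG⟩ := hrep φT φ hφ
    have : dualOp L φT = innerSL ℝ G := by
      ext v
      exact hG v _ (hξ v)
    rw [this, ← hGn]
    exact innerSL_apply_norm ℝ G

end ControlOperator
end EvolutionControl

theorem mainTheorem8
    {X : Type u} [NormedAddCommGroup X] [InnerProductSpace ℝ X] [CompleteSpace X]
    {V : Type v} [NormedAddCommGroup V] [InnerProductSpace ℝ V] [CompleteSpace V]
    (T : ℝ) (hT : 0 < T)
    -- `A` generates the `C₀`-semigroup `S`
    (A : X →ₗ.[ℝ] X) (S : EvolutionControl.C0Semigroup X) (hA : EvolutionControl.IsGenerator A S)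
    -- the nonlinearity: strongly measurable in `t`, continuously differentiable in `(y, u)`
    (F : ℝ → X → V → X)
    (hF_meas : ∀ (x : X) (w : V),
      AEStronglyMeasurable (fun t => F t x w) (EvolutionControl.timeMeasure T))
    (hF_diff : ∀ t ∈ Icc 0 T, ContDiff ℝ 1 (fun p : X × V => F t p.1 p.2))
    -- the reference control `ub`, with trajectory `yb` from `y₀` to `y₁`
    (y₀ y₁ : X) (ub : ℝ → V) (hub : MemLp ub 2 (EvolutionControl.timeMeasure T))
    (yb : ℝ → X) (hyb : EvolutionControl.IsMildSolution S T (fun t x => F t x (ub t)) y₀ yb)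
    (hyb_end : yb T = y₁)
    (hFy : MemLp (EvolutionControl.partialY F yb ub) 1 (EvolutionControl.timeMeasure T))
    (hFu : MemLp (EvolutionControl.partialU F yb ub) 2 (EvolutionControl.timeMeasure T)) :
    List.TFAE [
      -- (1) the reachable set is finite codimensional
      EvolutionControl.IsFiniteCodimSet
        (EvolutionControl.reachableSet S T
          (EvolutionControl.partialY F yb ub) (EvolutionControl.partialU F yb ub)),
      -- (2) estimate on a finite codimensional subspace
      ∃ X₁ : Submodule ℝ (StrongDual ℝ X), X₁.CoFG ∧ ∃ C : ℝ, 0 < C ∧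
        ∀ φT ∈ X₁, ∀ φ : ℝ → StrongDual ℝ X,
          EvolutionControl.IsAdjointMildSolution S T (EvolutionControl.partialY F yb ub) φT φ →
          ‖φT‖ ≤ C * lpNorm
            (fun t => EvolutionControl.dualOp (EvolutionControl.partialU F yb ub t) (φ t)) 2
            (EvolutionControl.timeMeasure T),
      -- (3) estimate with an added compact term
      ∃ (W : Type w) (_ : NormedAddCommGroup W) (_ : NormedSpace ℝ W) (_ : CompleteSpace W)
        (G : StrongDual ℝ X →L[ℝ] W), IsCompactOperator G ∧ ∃ C : ℝ, 0 < C ∧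
        ∀ (φT : StrongDual ℝ X) (φ : ℝ → StrongDual ℝ X),
          EvolutionControl.IsAdjointMildSolution S T (EvolutionControl.partialY F yb ub) φT φ →
          ‖φT‖ ≤ C * (lpNorm
            (fun t => EvolutionControl.dualOp (EvolutionControl.partialU F yb ub t) (φ t)) 2
            (EvolutionControl.timeMeasure T) + ‖G φT‖)] := by

  have hB : Integrable (EvolutionControl.partialY F yb ub) (EvolutionControl.timeMeasure T) :=
    memLp_one_iff_integrable.1 hFy
  obtain ⟨L, hreach, hnorm⟩ := EvolutionControl.exists_endpoint_operator S hT.le hB hFu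
  rw [hreach]
  tfae_have 1 → 2 := fun h => by
    obtain ⟨X₁, hX₁, C, hC, hest⟩ := EvolutionControl.exists_estimate_of_isFiniteCodimSet L h
    exact ⟨X₁, hX₁, C, hC, fun φT hφT φ hφ => hnorm φT φ hφ ▸ hest φT hφT⟩
  tfae_have 2 → 3 := by
    rintro ⟨X₁, hX₁, C, hC, hest⟩
    obtain ⟨W, i₁, i₂, i₃, G, hG, C', hC', hest'⟩ :=
      EvolutionControl.exists_compact_estimate_of_estimate.{w} (EvolutionControl.dualOp L)
        ⟨X₁, hX₁, C, hC, fun φT hφT => by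
          obtain ⟨φ, hφ⟩ := EvolutionControl.exists_isAdjointMildSolution S hT.le hB φT
          rw [hnorm φT φ hφ]
          exact hest φT hφT φ hφ⟩
    exact ⟨W, i₁, i₂, i₃, G, hG, C', hC', fun φT φ hφ => hnorm φT φ hφ ▸ hest' φT⟩
  tfae_have 3 → 1 := by
    rintro ⟨W, i₁, i₂, i₃, G, hG, C, hC, hest⟩
    refine EvolutionControl.isFiniteCodimSet_of_compact_estimate L hG (C := C) fun φT => ?_
    obtain ⟨φ, hφ⟩ := EvolutionControl.exists_isAdjointMildSolution S hT.le hB φT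
    rw [hnorm φT φ hφ]
    exact hest φT φ hφ
  tfae_finish
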